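/- Let $N\ge 1$, let $\mathcal H_1=\mathbb C^d$ be a $d$-dimensional one-particle Hilbert space, let $\mathcal H_N=\wedge^N[\mathcal H_1]$ be the $N$-fermion Hilbert space (the antisymmetric subspace of $\mathcal H_1^{\otimes N}$) and let $D=\dim\mathcal H_N$. Let $V$ be a Hermitian operator on $\mathcal H_N$ and let $w=(w_1,\dots,w_D)$ be a weight vector, i.e. $w_1\ge\dots\ge w_D\ge 0$ and $\sum_j w_j=1$. Let $\mathcal E^N$ be the set of density operators on $\mathcal H_N$ (positive semidefinite operators of trace one), and let $\mathcal E^N(w)$ be the set of those whose decreasingly ordered spectrum (with multiplicities) is $w$. An operator $\Gamma$ on $\mathcal H_N$, extended by zero to $\mathcal H_1^{\otimes N}$, has the one-particle reduced density matrix (1RDM) $\gamma=N\,\mathrm{Tr}_{N-1}[\Gamma]$, where $\mathrm{Tr}_{N-1}$ is the partial trace over all particles but one; this is written $\Gamma\mapsto\gamma$. Let $\mathcal E^1_N(w)=N\,\mathrm{Tr}_{N-1}[\mathcal E^N(w)]$ be the set of $w$-ensemble $N$-representable 1RDMs. For weight vectors $v,w$ write $v\prec w$ ($v$ is majorized by $w$)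 if for every $k=1,\dots,D$ the sum of the $k$ largest entries of $v$ is at most the sum of the $k$ largest entries of $w$. The universal functional is $$\mathcal F_w(\gamma)=\min_{\mathcal E^N(w)\ni\Gamma\mapsto\gamma}\mathrm{Tr}[\Gamma V]\quad\text{for }\gamma\in\mathcal E^1_N(w),\qquad \mathcal F_w(\gamma)=\infty\ \text{ otherwise},$$ and the relaxed functional $\overline{\mathcal F}_w=\mathrm{conv}(\mathcal F_w)$ is its lower convex envelope, i.e. the largest convex function that is nowhere larger than $\mathcal F_w$, considered on $\mathrm{conv}(\mathcal E^1_N(w))$. Then the minimum defining $\mathcal F_w(\gamma)$ is attained for every $\gamma\in\mathcal E^1_N(w)$, and: 1. For every $\gamma\in\mathrm{conv}(\mathcal E^1_N(w))$, $$\overline{\mathcal F}_w(\gamma)=\min_{\mathrm{conv}(\mathcal E^N(w))\ni\Gamma\mapsto\gamma}\mathrm{Tr}[\Gamma V],$$ where the minimum is attained. 2. The convex hull of $\mathcal E^N(w)$ is $$\mathrm{conv}(\mathcal E^N(w))=\bigcup_{w'\prec w}\mathcal E^N(w')=\{\Gamma\in\mathcal E^N:\mathrm{spec}(\Gamma)\prec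 w\},$$ where the union is over all weight vectors $w'\prec w$. 3. The convex hull of $\mathcal E^1_N(w)$ is $$\mathrm{conv}(\mathcal E^1_N(w))=N\,\mathrm{Tr}_{N-1}[\mathrm{conv}(\mathcal E^N(w))]=\bigcup_{w'\prec w}\mathcal E^1_N(w').$$ -/

import Mathlib

noncomputable section

/-! ### The `N`-fermion Hilbert space -/

/-- The `N`-particle space `H₁ ⊗ ⋯ ⊗ H₁` over the one-particle space `H₁ = ℂ^d`: wave functions of
`N` one-particle indices with the `ℓ²` inner product (coordinates with respect to the product
basis `e_{x 0} ⊗ ⋯ ⊗ e_{x (N-1)}`). -/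
abbrev TensorSpace (N d : ℕ) : Type := EuclideanSpace ℂ (Fin N → Fin d)

/-- The `N`-fermion Hilbert space `⋀^N H₁`: the antisymmetric wave functions, with the inner
product inherited from the `N`-particle space. -/
def FermionSpace (N d : ℕ) : Submodule ℂ (TensorSpace N d) where
  carrier := {ψ | ∀ (σ : Equiv.Perm (Fin N)) (x : Fin N → Fin d),
    ψ (x ∘ σ) = ((Equiv.Perm.sign σ : ℤ) : ℂ) * ψ x}
  zero_mem' := by intro σ x; simp
  add_mem' := by
    intro a b ha hb σ x
    simp only [PiLp.add_apply, ha σ x, hb σ x]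
    ring
  smul_mem' := by
    intro c a ha σ x
    simp only [PiLp.smul_apply, smul_eq_mul, ha σ x]
    ring

/-- Linear operators on the `N`-fermion Hilbert space. -/
abbrev FermionOp (N d : ℕ) : Type := FermionSpace N d →ₗ[ℂ] FermionSpace N d

/-- The dimension `D` of the `N`-fermion Hilbert space. -/
abbrev fermionDim (N d : ℕ) : ℕ := Module.finrank ℂ (FermionSpace N d)

/-! ### Density operators, spectra and majorization -/

/-- Hermitian `N`-fermion operators. -/
abbrev IsHermitianOp {N d : ℕ} (A : FermionOp N d) : Prop :=
  LinearMap.IsSymmetric (𝕜 := ℂ) (E := FermionSpace N d) A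

/-- The set `𝓔^N` of all `N`-fermion density operators: positive semidefinite, of trace one. -/
def densityOps (N d : ℕ) : Set (FermionOp N d) :=
  {Γ | LinearMap.IsPositive (𝕜 := ℂ) (E := FermionSpace N d) Γ ∧
    LinearMap.trace ℂ (FermionSpace N d) Γ = 1}

/-- The spectrum of a Hermitian operator as a decreasingly ordered vector of `D` eigenvalues,
repeated according to multiplicity. -/
def spec {N d : ℕ} {Γ : FermionOp N d} (hΓ : IsHermitianOp Γ) : Fin (fermionDim N d) → ℝ :=
  LinearMap.IsSymmetric.eigenvalues hΓ rfl

/-- The set `𝓔^N(w)` of `N`-fermion density operators with decreasingly ordered spectrum `w`. -/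
def fixedSpecOps {N d : ℕ} (w : Fin (fermionDim N d) → ℝ) : Set (FermionOp N d) :=
  {Γ | Γ ∈ densityOps N d ∧ ∃ hΓ : IsHermitianOp Γ, spec hΓ = w}

/-- Decreasingly ordered probability vectors. -/
structure IsWeightVector {D : ℕ} (w : Fin D → ℝ) : Prop where
  antitone : Antitone w
  nonneg : ∀ i, 0 ≤ w i
  sum_eq_one : ∑ i, w i = 1

/-- The decreasing rearrangement `v↓` of a vector `v`. -/
def sortDesc {D : ℕ} (v : Fin D → ℝ) : Fin D → ℝ := fun i => v (Tuple.sort v i.rev)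

/-- Majorization `v ≺ w`: every partial sum of `v↓` is at most the corresponding partial sum of
`w↓`. (It is used for vectors with the same total sum `1` only, so that equality of the total sums
is automatic.) -/
def Majorized {D : ℕ} (v w : Fin D → ℝ) : Prop :=
  ∀ k : Fin D, ∑ i ∈ Finset.Iic k, sortDesc v i ≤ ∑ i ∈ Finset.Iic k, sortDesc w i

/-! ### One-particle reduced density matrices -/

/-- The matrix of an `N`-fermion operator in the product basis of the full `N`-particle space; the
operator is extended by zero on the orthogonal complement of the antisymmetric subspace. -/
def fermionMatrix {N d : ℕ} (Γ : FermionOp N d) :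
    Matrix (Fin N → Fin d) (Fin N → Fin d) ℂ :=
  fun x y =>
    (Γ ((FermionSpace N d).orthogonalProjectionOnto (EuclideanSpace.single y 1)) :
      TensorSpace N d) x

/-- The partial trace `Tr_{N-1}` over all particles but the first:
`(i, j) ↦ ∑_{x₂,…,x_N} A (i, x₂, …, x_N) (j, x₂, …, x_N)`. -/
def partialTrace {N d : ℕ} [NeZero N] (A : Matrix (Fin N → Fin d) (Fin N → Fin d) ℂ) :
    Matrix (Fin d) (Fin d) ℂ :=
  fun i j => ∑ x : Fin N → Fin d with x 0 = i, A x (Function.update x 0 j)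

/-- The one-particle reduced density matrix `γ = N Tr_{N-1}[Γ]`; `Γ ↦ γ` means
`oneRDM Γ = γ`. -/
def oneRDM {N d : ℕ} [NeZero N] (Γ : FermionOp N d) : Matrix (Fin d) (Fin d) ℂ :=
  (N : ℂ) • partialTrace (fermionMatrix Γ)

/-- The set `𝓔^1_N(w) = N Tr_{N-1}[𝓔^N(w)]` of `w`-ensemble `N`-representable 1RDMs. -/
def fixedSpecRDMs {N d : ℕ} [NeZero N] (w : Fin (fermionDim N d) → ℝ) :
    Set (Matrix (Fin d) (Fin d) ℂ) :=
  oneRDM '' fixedSpecOps w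

/-! ### Convex envelopes and the universal functionals -/

/-- An extended-real-valued function is convex if its epigraph is convex. -/
def IsConvexFun {X : Type*} [AddCommGroup X] [Module ℝ X] (g : X → EReal) : Prop :=
  Convex ℝ {p : X × ℝ | g p.1 ≤ (p.2 : EReal)}

/-- The lower convex envelope `conv f`: the pointwise supremum of all convex functions below `f`
(that is, the largest convex function below `f`). -/
def lowerConvexEnvelope {X : Type*} [AddCommGroup X] [Module ℝ X] (f : X → EReal) : X → EReal :=
  fun x => ⨆ g ∈ {g : X → EReal | IsConvexFun g ∧ g ≤ f}, g x

/-- `Tr[Γ V]`, which is real for Hermitian `Γ` and `V`. -/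
def interactionEnergy {N d : ℕ} (V Γ : FermionOp N d) : ℝ :=
  (LinearMap.trace ℂ (FermionSpace N d) (Γ ∘ₗ V)).re

/-- The values `Tr[Γ V]` for `Γ` in the search space `S` with `Γ ↦ γ`. -/
def searchValues {N d : ℕ} [NeZero N] (V : FermionOp N d) (S : Set (FermionOp N d))
    (γ : Matrix (Fin d) (Fin d) ℂ) : Set EReal :=
  {e | ∃ Γ ∈ S, oneRDM Γ = γ ∧ e = (interactionEnergy V Γ : EReal)}

/-- The universal functional `𝓕_w(γ)`, the constrained search over `𝓔^N(w)`. Its value is `∞`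
outside of `𝓔^1_N(w)`. -/
def universalFunctional {N d : ℕ} [NeZero N] (V : FermionOp N d) (w : Fin (fermionDim N d) → ℝ) :
    Matrix (Fin d) (Fin d) ℂ → EReal :=
  fun γ => sInf (searchValues V (fixedSpecOps w) γ)

/-- The relaxed functional: the lower convex envelope of `𝓕_w`. -/
def relaxedFunctional {N d : ℕ} [NeZero N] (V : FermionOp N d) (w : Fin (fermionDim N d) → ℝ) :
    Matrix (Fin d) (Fin d) ℂ → EReal :=
  lowerConvexEnvelope (universalFunctional V w)

end

/-! ### Majorization -/

/-! Everything reduces to a description of the convex hull of `fixedSpecOps w` by linear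
inequalities. Ky Fan's principle places the orbit inside `kyFanOps w`, which is convex, so the hull
lies there too. Testing Ky Fan's inequalities on an eigenbasis gives majorization of the spectrum,
and Rado's theorem, transported through a diagonalization, leads back to the hull. The cycle of
inclusions closes, and it also shows that the hull is closed, hence compact.

Compactness makes the constrained searches attain their minima. The search over the hull is convex
in `γ`, since its epigraph is a linear image of a convex set; it lies below `𝓕_w`. Any other convex
minorant `g` satisfies `g (oneRDM Γ) ≤ Tr[Γ V]` on the orbit, and this extends to the hull by
linearity. The statements on 1RDMs follow because linear maps commute with convex hulls. -/

theorem sortDesc_eq_self {D : ℕ} {v : Fin D → ℝ} (hv : Antitone v) : sortDesc v = v := by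
  have hrev : Monotone (v ∘ (Fin.revPerm : Equiv.Perm (Fin D))) := fun i j hij =>
    hv (Fin.rev_le_rev.mpr hij)
  funext i
  simpa [sortDesc] using (congrFun (Tuple.comp_sort_eq_comp_iff_monotone.mpr hrev) i.rev).symm

theorem majorized_iff_of_antitone {D : ℕ} {v w : Fin D → ℝ} (hv : Antitone v) (hw : Antitone w) :
    Majorized v w ↔ ∀ k, ∑ i ∈ Finset.Iic k, v i ≤ ∑ i ∈ Finset.Iic k, w i := by
  rw [Majorized, sortDesc_eq_self hv, sortDesc_eq_self hw]

/-- Abel summation by induction: the sum of all but the last `u i` is nonnegative, so its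
coefficient may be lowered to the last `c`. Keeping that coefficient on the left allows `c` of any
sign; in the application the total of `u` is zero. -/
theorem last_mul_sum_le_sum_mul {n : ℕ} {c u : Fin (n + 1) → ℝ} (hc : Antitone c)
    (hu : ∀ k, 0 ≤ ∑ i ∈ Finset.Iic k, u i) :
    c (Fin.last n) * ∑ i, u i ≤ ∑ i, c i * u i := by
  induction n with
  | zero => simp
  | succ n ih =>
    have hu' : ∀ k : Fin (n + 1), 0 ≤ ∑ i ∈ Finset.Iic k, u i.castSucc := fun k => by
      have := hu k.castSucc
      rwa [← Fin.map_castSuccEmb_Iic, Finset.sum_map] at this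
    have key := ih (c := fun i => c i.castSucc) (u := fun i => u i.castSucc)
      (fun i j hij => hc (Fin.castSucc_le_castSucc_iff.mpr hij)) hu'
    have hS := hu' (Fin.last n)
    have hle : c (Fin.last (n + 1)) ≤ c (Fin.last n).castSucc := hc (Fin.le_last _)
    rw [show Finset.Iic (Fin.last n) = Finset.univ from by ext; simp [Fin.le_last]] at hS
    rw [Fin.sum_univ_castSucc, Fin.sum_univ_castSucc (f := fun i => c i * u i)]
    nlinarith [mul_le_mul_of_nonneg_right hle hS]

/-- Abel summation against an antitone vector is monotone in the partial sums. -/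
theorem sum_mul_le_sum_mul_of_partial_sums {D : ℕ} {c v w : Fin D → ℝ} (hc : Antitone c)
    (hvw : ∀ k, ∑ i ∈ Finset.Iic k, v i ≤ ∑ i ∈ Finset.Iic k, w i) (hsum : ∑ i, v i = ∑ i, w i) :
    ∑ i, c i * v i ≤ ∑ i, c i * w i := by
  cases D with
  | zero => simp
  | succ n =>
    have h := last_mul_sum_le_sum_mul (u := fun i => w i - v i) hc fun k => by
      simpa [Finset.sum_sub_distrib] using hvw k
    simp only [Finset.sum_sub_distrib, hsum, sub_self, mul_zero, mul_sub] at h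
    linarith

/-- A decreasing vector majorized by `w` is a convex combination of permutations of `w`. -/
theorem mem_convexHull_perm_of_partial_sums {D : ℕ} {v w : Fin D → ℝ} (hv : Antitone v)
    (hvw : ∀ k, ∑ i ∈ Finset.Iic k, v i ≤ ∑ i ∈ Finset.Iic k, w i) (hsum : ∑ i, v i = ∑ i, w i) :
    v ∈ convexHull ℝ (Set.range fun σ : Equiv.Perm (Fin D) => w ∘ σ) := by
  by_contra hnot
  obtain ⟨f, u, hlt, hv'⟩ := geometric_hahn_banach_closed_point (convex_convexHull ℝ _)
    ((Set.finite_range fun σ : Equiv.Perm (Fin D) => w ∘ σ).isClosed_convexHull ℝ) hnot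
  set c : Fin D → ℝ := fun i => f (Pi.single i 1) with hc_def
  have hf : ∀ x : Fin D → ℝ, f x = ∑ i, x i * c i := fun x => by
    conv_lhs => rw [pi_eq_sum_univ' x]
    simp [hc_def]
  -- `τ` lists the coefficients of the separating functional in decreasing order. By rearrangement
  -- and then Abel summation, the vertex `w ∘ τ⁻¹` has a value at least that of `v`, against the
  -- separation.
  set τ : Equiv.Perm (Fin D) := Fin.revPerm.trans (Tuple.sort c) with hτ
  have hanti : Antitone (c ∘ τ) := fun i j hij =>
    Tuple.monotone_sort c (Fin.rev_le_rev.mpr hij)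
  have h1 : ∑ i, v i * c i ≤ ∑ i, v i * c (τ i) := by
    have hmono : Monovary v (c ∘ τ) := hv.monovary hanti
    simpa using hmono.sum_smul_comp_perm_le_sum_smul (σ := τ⁻¹)
  have h2 : ∑ i, v i * c (τ i) ≤ ∑ i, w i * c (τ i) := by
    simpa [mul_comm] using sum_mul_le_sum_mul_of_partial_sums hanti hvw hsum
  have h3 : f (w ∘ (τ⁻¹ : Equiv.Perm (Fin D))) = ∑ i, w i * c (τ i) := by
    rw [hf, ← Equiv.sum_comp τ]
    simp
  have h4 := hlt _ (subset_convexHull ℝ _ ⟨τ⁻¹, rfl⟩)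
  rw [hf] at hv'
  linarith

/-- The scalar inequality behind Ky Fan's maximum principle. -/
theorem sum_mul_le_sum_Iic {D : ℕ} {w p : Fin D → ℝ} (hw : Antitone w) (k : Fin D)
    (hp0 : ∀ i, 0 ≤ p i) (hp1 : ∀ i, p i ≤ 1) (hp : ∑ i, p i = (Finset.Iic k).card) :
    ∑ i, w i * p i ≤ ∑ i ∈ Finset.Iic k, w i := by
  -- After subtracting `w k` the weights change sign at `k`, so `p` is best replaced by the
  -- indicator of `Iic k`; the prescribed total of `p` cancels the shift.
  have h : ∀ i, (w i - w k) * p i ≤ if i ∈ Finset.Iic k then w i - w k else 0 := fun i => by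
    split_ifs with hi
    · exact mul_le_of_le_one_right (sub_nonneg.mpr (hw (Finset.mem_Iic.mp hi))) (hp1 i)
    · have : w i ≤ w k := hw (le_of_lt (by simpa using hi))
      exact mul_nonpos_of_nonpos_of_nonneg (by linarith) (hp0 i)
  have hs := Finset.sum_le_sum fun i (_ : i ∈ Finset.univ) => h i
  simp only [sub_mul, Finset.sum_sub_distrib, ← Finset.mul_sum, hp, Finset.sum_ite_mem,
    Finset.univ_inter, Finset.sum_const, nsmul_eq_mul] at hs
  linarith

/-! ### Operators diagonal in an orthonormal family -/

section DiagonalOp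

variable {E : Type*} [NormedAddCommGroup E] [InnerProductSpace ℂ E] {n : ℕ}

/-- The operator `∑ i, l i |b i⟩⟨b i|`. -/
noncomputable def diagonalOp (b : Fin n → E) (l : Fin n → ℝ) : E →L[ℂ] E :=
  ∑ i, (l i : ℂ) • InnerProductSpace.rankOne ℂ (b i) (b i)

theorem diagonalOp_apply (b : Fin n → E) (l : Fin n → ℝ) (x : E) :
    diagonalOp b l x = ∑ i, (l i : ℂ) • inner ℂ (b i) x • b i := by
  simp [diagonalOp]

theorem diagonalOp_apply_basis {b : Fin n → E} (hb : Orthonormal ℂ b) (l : Fin n → ℝ) (i : Fin n) :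
    diagonalOp b l (b i) = (l i : ℂ) • b i := by
  rw [diagonalOp_apply, Finset.sum_eq_single i]
  · simp [inner_self_eq_norm_sq_to_K, hb.1 i]
  · intro j _ hj
    simp [hb.2 hj]
  · simp

theorem isPositive_diagonalOp (b : Fin n → E) {l : Fin n → ℝ} (hl : ∀ i, 0 ≤ l i) :
    (diagonalOp b l : E →ₗ[ℂ] E).IsPositive := by
  rw [ContinuousLinearMap.isPositive_toLinearMap_iff]
  refine ContinuousLinearMap.isPositive_sum _ fun i _ => ?_
  exact (InnerProductSpace.isPositive_rankOne_self (b i)).smul_of_nonneg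
    (Complex.zero_le_real.mpr (hl i))

theorem inner_diagonalOp_self (b : Fin n → E) (l : Fin n → ℝ) (x : E) :
    (inner ℂ x (diagonalOp b l x)).re = ∑ i, l i * ‖inner ℂ (b i) x‖ ^ 2 := by
  simp only [diagonalOp_apply, inner_sum, inner_smul_right, Complex.re_sum]
  refine Finset.sum_congr rfl fun i _ => ?_
  rw [← inner_conj_symm x (b i), RCLike.mul_conj, Complex.re_ofReal_mul]
  norm_cast

theorem trace_diagonalOp [FiniteDimensional ℂ E] {b : Fin n → E} (hb : Orthonormal ℂ b)
    (l : Fin n → ℝ) :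
    LinearMap.trace ℂ E (diagonalOp b l : E →ₗ[ℂ] E) = ((∑ i, l i : ℝ) : ℂ) := by
  simp [diagonalOp, InnerProductSpace.trace_rankOne, inner_self_eq_norm_sq_to_K, hb.1]

/-- `diagonalOp` as a linear map of the diagonal. -/
noncomputable def diagonalOpLinear (b : Fin n → E) : (Fin n → ℝ) →ₗ[ℝ] (E →L[ℂ] E) where
  toFun := diagonalOp b
  map_add' l m := by simp [diagonalOp, add_smul, Finset.sum_add_distrib]
  map_smul' r l := by
    simp [diagonalOp, mul_smul, Finset.smul_sum]

theorem continuous_diagonalOp (l : Fin n → ℝ) :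
    Continuous fun b : Fin n → E => diagonalOp b l := by
  unfold diagonalOp
  refine continuous_finsetSum _ fun i _ => ?_
  have hi : Continuous fun b : Fin n → E => b i := continuous_apply i
  exact ((ContinuousLinearMap.smulRightL ℂ E E).continuous₂.comp
    (((innerSL ℂ).continuous.comp hi).prodMk hi)).const_smul (l i : ℂ)

theorem LinearMap.IsSymmetric.eq_diagonalOp [FiniteDimensional ℂ E] {T : E →ₗ[ℂ] E}
    (hT : T.IsSymmetric) (hn : Module.finrank ℂ E = n) :
    T = diagonalOp (hT.eigenvectorBasis hn) (hT.eigenvalues hn) := by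
  refine (hT.eigenvectorBasis hn).toBasis.ext fun i => ?_
  simp [diagonalOp_apply_basis (hT.eigenvectorBasis hn).orthonormal]

/-- Both lists are the roots of the characteristic polynomial with multiplicity, and a decreasing
list is determined by its multiset. -/
theorem eigenvalues_eq_of_apply_basis [FiniteDimensional ℂ E] {T : E →ₗ[ℂ] E}
    (hT : T.IsSymmetric) (hn : Module.finrank ℂ E = n) (b : OrthonormalBasis (Fin n) ℂ E)
    {w : Fin n → ℝ} (hw : Antitone w) (σ : Equiv.Perm (Fin n))
    (h : ∀ i, T (b i) = (w (σ i) : ℂ) • b i) : hT.eigenvalues hn = w := by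
  have hM : LinearMap.toMatrix b.toBasis b.toBasis T =
      Matrix.diagonal fun i => ((w (σ i) : ℝ) : ℂ) := by
    ext i j
    rw [LinearMap.toMatrix_apply, b.coe_toBasis, h, map_smul, Finsupp.smul_apply,
      b.coe_toBasis_repr_apply, b.repr_self, PiLp.single_apply, Matrix.diagonal_apply]
    aesop
  have hroots : T.charpoly.roots =
      Multiset.map (fun i => ((w (σ i) : ℝ) : ℂ)) Finset.univ.val := by
    rw [← LinearMap.charpoly_toMatrix _ b.toBasis, hM, Matrix.charpoly_diagonal,
      Polynomial.roots_prod _ _ (by simp [Finset.prod_ne_zero_iff, Polynomial.X_sub_C_ne_zero])]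
    simp
  rw [hT.roots_charpoly_eq_eigenvalues hn] at hroots
  have hre := congrArg (Multiset.map Complex.re) hroots
  simp only [Multiset.map_map, Function.comp_def, Complex.coe_algebraMap, Complex.ofReal_re] at hre
  simp only [Fin.univ_val_map, Multiset.coe_eq_coe] at hre
  refine List.ofFn_injective ((hre.trans (σ.ofFn_comp_perm w)).eq_of_pairwise'
    (hT.eigenvalues_antitone hn).sortedGE_ofFn.pairwise hw.sortedGE_ofFn.pairwise)

/-- Ky Fan's inequality. -/
theorem sum_inner_diagonalOp_le {b : Fin n → E} {w : Fin n → ℝ} (hw : Antitone w)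
    (hb : Orthonormal ℂ b) (b' : OrthonormalBasis (Fin n) ℂ E) (k : Fin n) :
    ∑ i ∈ Finset.Iic k, (inner ℂ (b i) (diagonalOp b' w (b i))).re ≤ ∑ i ∈ Finset.Iic k, w i := by
  simp only [inner_diagonalOp_self]
  rw [Finset.sum_comm]
  simp only [← Finset.mul_sum]
  -- The weight of `w j` is the squared length of the projection of `b' j` onto the first vectors of
  -- `b`: Bessel bounds it by one, Parseval gives the total.
  refine sum_mul_le_sum_Iic hw k (fun j => by positivity) (fun j => ?_) ?_
  · have h := hb.sum_inner_products_le (b' j) (s := Finset.Iic k)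
    simpa [norm_inner_symm] using h
  · rw [Finset.sum_comm]
    simp [b'.sum_sq_norm_inner_right, hb.1]

theorem isCompact_setOf_orthonormal [FiniteDimensional ℂ E] :
    IsCompact {b : Fin n → E | Orthonormal ℂ b} := by
  have : ProperSpace E := FiniteDimensional.proper ℂ E
  refine Metric.isCompact_of_isClosed_isBounded ?_ ?_
  · simp only [orthonormal_iff_ite, Set.ofPred_forall]
    exact isClosed_iInter fun i => isClosed_iInter fun j =>
      isClosed_eq (by fun_prop) continuous_const
  · refine (Metric.isBounded_closedBall (x := (0 : Fin n → E)) (r := 1)).subset fun b hb => ?_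
    rw [mem_closedBall_zero_iff, pi_norm_le_iff_of_nonneg zero_le_one]
    exact fun i => (hb.1 i).le

theorem Orthonormal.exists_orthonormalBasis_eq [FiniteDimensional ℂ E] {b : Fin n → E}
    (hb : Orthonormal ℂ b) (hn : Module.finrank ℂ E = n) :
    ∃ b' : OrthonormalBasis (Fin n) ℂ E, ⇑b' = b :=
  ⟨OrthonormalBasis.mk hb
    (hb.linearIndependent.span_eq_top_of_card_eq_finrank' (by simp [hn])).ge, by simp⟩

theorem re_inner_real_combination (r s : ℝ) (x y z : E) :
    (inner ℂ x ((r : ℂ) • y + (s : ℂ) • z)).re =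
      r * (inner ℂ x y).re + s * (inner ℂ x z).re := by
  rw [inner_add_right, inner_smul_right, inner_smul_right, Complex.add_re,
    Complex.re_ofReal_mul, Complex.re_ofReal_mul]

theorem LinearMap.IsSymmetric.re_inner_eigenvectorBasis [FiniteDimensional ℂ E] {T : E →ₗ[ℂ] E}
    (hT : T.IsSymmetric) (hn : Module.finrank ℂ E = n) (i : Fin n) :
    (inner ℂ (hT.eigenvectorBasis hn i) (T (hT.eigenvectorBasis hn i))).re =
      hT.eigenvalues hn i := by
  simp [inner_self_eq_norm_sq_to_K]

theorem isBounded_image_convexHull [FiniteDimensional ℂ E] {S : Set (E →ₗ[ℂ] E)}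
    (hS : Bornology.IsBounded (LinearMap.toContinuousLinearMap '' S)) :
    Bornology.IsBounded (LinearMap.toContinuousLinearMap '' convexHull ℝ S) := by
  let e : (E →ₗ[ℂ] E) →ₗ[ℝ] (E →L[ℂ] E) :=
    LinearMap.toContinuousLinearMap.toLinearMap.restrictScalars ℝ
  have h : LinearMap.toContinuousLinearMap '' convexHull ℝ S =
      convexHull ℝ (LinearMap.toContinuousLinearMap '' S) := e.image_convexHull S
  rw [h]
  exact isBounded_convexHull.mpr hS

theorem isCompact_of_isClosed_isBounded_of_clm [FiniteDimensional ℂ E] {S : Set (E →L[ℂ] E)}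
    (hc : IsClosed S) (hb : Bornology.IsBounded S) : IsCompact S := by
  have : ProperSpace (E →L[ℂ] E) := FiniteDimensional.proper ℂ _
  exact Metric.isCompact_of_isClosed_isBounded hc hb

theorem isClosed_setOf_positive_kyFan [FiniteDimensional ℂ E] (w : Fin n → ℝ) :
    IsClosed {T : E →L[ℂ] E | ((T : E →ₗ[ℂ] E).IsPositive ∧
      LinearMap.trace ℂ E (T : E →ₗ[ℂ] E) = 1) ∧ ∀ b : Fin n → E, Orthonormal ℂ b →
        ∀ k, ∑ i ∈ Finset.Iic k, (inner ℂ (b i) (T (b i))).re ≤ ∑ i ∈ Finset.Iic k, w i} := by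
  have htr : Continuous fun T : E →L[ℂ] E => LinearMap.trace ℂ E (T : E →ₗ[ℂ] E) :=
    (LinearMap.trace ℂ E ∘ₗ ContinuousLinearMap.coeLM ℂ).continuous_of_finiteDimensional
  simp only [LinearMap.IsPositive, LinearMap.IsSymmetric, ContinuousLinearMap.coe_coe,
    RCLike.re_to_complex, Set.ofPred_and, Set.ofPred_forall]
  refine IsClosed.inter (IsClosed.inter (IsClosed.inter ?_ ?_) ?_) ?_
  · exact isClosed_iInter fun x => isClosed_iInter fun y => isClosed_eq (by fun_prop) (by fun_prop)
  · exact isClosed_iInter fun x => isClosed_le (by fun_prop) (by fun_prop)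
  · exact isClosed_eq htr continuous_const
  · exact isClosed_iInter fun b => isClosed_iInter fun _ => isClosed_iInter fun k =>
      isClosed_le (by fun_prop) (by fun_prop)

end DiagonalOp

/-! ### The convex hull of the density operators with fixed spectrum -/

section FixedSpectrum

variable {N d : ℕ}

theorem isWeightVector_spec {Γ : FermionOp N d} (hΓ : Γ ∈ densityOps N d) :
    IsWeightVector (spec hΓ.1.isSymmetric) where
  antitone := hΓ.1.isSymmetric.eigenvalues_antitone rfl
  nonneg := hΓ.1.nonneg_eigenvalues rfl
  sum_eq_one := by
    have h := hΓ.1.isSymmetric.trace_eq_sum_eigenvalues rfl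
    exact Complex.ofReal_injective (h.symm.trans (hΓ.2.trans Complex.ofReal_one.symm))

theorem diagonalOp_comp_perm_mem_fixedSpecOps {w : Fin (fermionDim N d) → ℝ}
    (hw : IsWeightVector w)
    (b : OrthonormalBasis (Fin (fermionDim N d)) ℂ (FermionSpace N d))
    (σ : Equiv.Perm (Fin (fermionDim N d))) :
    (diagonalOp b (w ∘ σ) : FermionOp N d) ∈ fixedSpecOps w := by
  have hpos : (diagonalOp b (w ∘ σ) : FermionOp N d).IsPositive :=
    isPositive_diagonalOp b fun i => hw.nonneg (σ i)
  refine ⟨⟨hpos, ?_⟩, hpos.isSymmetric, ?_⟩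
  · rw [trace_diagonalOp b.orthonormal]
    simp [Equiv.sum_comp σ w, hw.sum_eq_one]
  · exact eigenvalues_eq_of_apply_basis _ rfl b hw.antitone σ fun i =>
      diagonalOp_apply_basis b.orthonormal _ i

theorem mem_fixedSpecOps_iff {w : Fin (fermionDim N d) → ℝ} (hw : IsWeightVector w)
    {Γ : FermionOp N d} : Γ ∈ fixedSpecOps w ↔
      ∃ b : OrthonormalBasis (Fin (fermionDim N d)) ℂ (FermionSpace N d), Γ = diagonalOp b w := by
  constructor
  · rintro ⟨-, hΓ, rfl⟩
    exact ⟨_, hΓ.eq_diagonalOp rfl⟩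
  · rintro ⟨b, rfl⟩
    exact diagonalOp_comp_perm_mem_fixedSpecOps hw b 1

/-- The density operators whose diagonal in every orthonormal family satisfies Ky Fan's
inequalities for `w`. -/
def kyFanOps (w : Fin (fermionDim N d) → ℝ) : Set (FermionOp N d) :=
  {Γ | Γ ∈ densityOps N d ∧ ∀ b : Fin (fermionDim N d) → FermionSpace N d, Orthonormal ℂ b →
    ∀ k, ∑ i ∈ Finset.Iic k, (inner ℂ (b i) (Γ (b i))).re ≤ ∑ i ∈ Finset.Iic k, w i}

theorem convex_densityOps : Convex ℝ (densityOps N d) := by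
  rintro A ⟨hA, hA1⟩ B ⟨hB, hB1⟩ r s hr hs hrs
  refine ⟨?_, ?_⟩
  · have h1 := hA.smul_of_nonneg (Complex.zero_le_real.mpr hr)
    have h2 := hB.smul_of_nonneg (Complex.zero_le_real.mpr hs)
    exact h1.add h2
  · have : r • A + s • B = (r : ℂ) • A + (s : ℂ) • B := rfl
    rw [this, map_add, map_smul, map_smul, hA1, hB1]
    simp only [smul_eq_mul, mul_one]
    exact_mod_cast hrs

theorem convex_kyFanOps (w : Fin (fermionDim N d) → ℝ) : Convex ℝ (kyFanOps w) := by
  intro A hA B hB r s hr hs hrs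
  refine ⟨convex_densityOps hA.1 hB.1 hr hs hrs, fun b hb k => ?_⟩
  have h : ∀ i, (inner ℂ (b i) ((r • A + s • B) (b i))).re =
      r * (inner ℂ (b i) (A (b i))).re + s * (inner ℂ (b i) (B (b i))).re := fun i => by
    have : (r • A + s • B) (b i) = (r : ℂ) • A (b i) + (s : ℂ) • B (b i) := rfl
    rw [this]
    exact re_inner_real_combination (E := FermionSpace N d) r s _ _ _
  simp only [h, Finset.sum_add_distrib, ← Finset.mul_sum]
  calc _ ≤ r * ∑ i ∈ Finset.Iic k, w i + s * ∑ i ∈ Finset.Iic k, w i :=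
        add_le_add (mul_le_mul_of_nonneg_left (hA.2 b hb k) hr)
          (mul_le_mul_of_nonneg_left (hB.2 b hb k) hs)
    _ = _ := by rw [← add_mul, hrs, one_mul]

theorem fixedSpecOps_subset_kyFanOps {w : Fin (fermionDim N d) → ℝ} (hw : IsWeightVector w) :
    fixedSpecOps w ⊆ kyFanOps w := by
  refine fun Γ hΓ => ⟨hΓ.1, fun b hb k => ?_⟩
  obtain ⟨b', rfl⟩ := (mem_fixedSpecOps_iff hw).mp hΓ
  exact sum_inner_diagonalOp_le hw.antitone hb b' k

theorem kyFanOps_subset_majorized {w : Fin (fermionDim N d) → ℝ} (hw : IsWeightVector w) :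
    kyFanOps w ⊆
      {Γ | Γ ∈ densityOps N d ∧ ∃ hΓ : IsHermitianOp Γ, Majorized (spec hΓ) w} := by
  rintro Γ ⟨hΓ, hk⟩
  have hs := hΓ.1.isSymmetric
  refine ⟨hΓ, hs, (majorized_iff_of_antitone (isWeightVector_spec hΓ).antitone
    hw.antitone).mpr fun k => ?_⟩
  have h := hk _ (hs.eigenvectorBasis rfl).orthonormal k
  exact (Finset.sum_congr rfl fun i _ => (hs.re_inner_eigenvectorBasis rfl i).symm).trans_le h

/-- In a fixed eigenbasis of `Γ`, the linear map from diagonals to operators carries Rado's convex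
combination of permutations of `w` to one of operators with spectrum `w`. -/
theorem majorized_subset_convexHull {w : Fin (fermionDim N d) → ℝ} (hw : IsWeightVector w) :
    {Γ | Γ ∈ densityOps N d ∧ ∃ hΓ : IsHermitianOp Γ, Majorized (spec hΓ) w} ⊆
      convexHull ℝ (fixedSpecOps w) := by
  rintro Γ ⟨hΓ, hs, hmaj⟩
  have hv := isWeightVector_spec hΓ
  have hmem := mem_convexHull_perm_of_partial_sums hv.antitone
    ((majorized_iff_of_antitone hv.antitone hw.antitone).mp hmaj)
    (hv.sum_eq_one.trans hw.sum_eq_one.symm)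
  let e : (FermionSpace N d →L[ℂ] FermionSpace N d) →ₗ[ℝ] FermionOp N d :=
    (ContinuousLinearMap.coeLM ℂ).restrictScalars ℝ
  let f := e ∘ₗ diagonalOpLinear (hs.eigenvectorBasis rfl)
  have himg := Set.mem_image_of_mem f hmem
  rw [LinearMap.image_convexHull] at himg
  rw [hs.eq_diagonalOp rfl]
  refine convexHull_mono ?_ himg
  rintro _ ⟨_, ⟨σ, rfl⟩, rfl⟩
  exact diagonalOp_comp_perm_mem_fixedSpecOps hw _ σ

theorem convexHull_fixedSpecOps_subset_kyFanOps {w : Fin (fermionDim N d) → ℝ}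
    (hw : IsWeightVector w) : convexHull ℝ (fixedSpecOps w) ⊆ kyFanOps w :=
  convexHull_min (fixedSpecOps_subset_kyFanOps hw) (convex_kyFanOps w)

theorem convexHull_fixedSpecOps_eq_kyFanOps {w : Fin (fermionDim N d) → ℝ}
    (hw : IsWeightVector w) : convexHull ℝ (fixedSpecOps w) = kyFanOps w :=
  (convexHull_fixedSpecOps_subset_kyFanOps hw).antisymm
    ((kyFanOps_subset_majorized hw).trans (majorized_subset_convexHull hw))

theorem convexHull_fixedSpecOps_eq_majorized {w : Fin (fermionDim N d) → ℝ}
    (hw : IsWeightVector w) : convexHull ℝ (fixedSpecOps w) =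
      {Γ | Γ ∈ densityOps N d ∧ ∃ hΓ : IsHermitianOp Γ, Majorized (spec hΓ) w} :=
  ((convexHull_fixedSpecOps_subset_kyFanOps hw).trans (kyFanOps_subset_majorized hw)).antisymm
    (majorized_subset_convexHull hw)

theorem majorized_eq_iUnion_fixedSpecOps (w : Fin (fermionDim N d) → ℝ) :
    {Γ | Γ ∈ densityOps N d ∧ ∃ hΓ : IsHermitianOp Γ, Majorized (spec hΓ) w} =
      ⋃ w' ∈ {w' | IsWeightVector w' ∧ Majorized w' w}, fixedSpecOps w' := by
  ext Γ
  simp only [Set.mem_ofPred_eq, Set.mem_iUnion, exists_prop]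
  constructor
  · rintro ⟨hΓ, hs, hmaj⟩
    exact ⟨spec hs, ⟨isWeightVector_spec hΓ, hmaj⟩, hΓ, hs, rfl⟩
  · rintro ⟨_, ⟨-, hmaj⟩, hΓ, hs, rfl⟩
    exact ⟨hΓ, hs, hmaj⟩

/-- The orbit is the continuous image of the compact set of orthonormal families of length `D`, each
of which is a basis. -/
theorem isCompact_fixedSpecOps {w : Fin (fermionDim N d) → ℝ} (hw : IsWeightVector w) :
    IsCompact (LinearMap.toContinuousLinearMap '' fixedSpecOps (N := N) (d := d) w) := by
  convert! (isCompact_setOf_orthonormal (E := FermionSpace N d) (n := fermionDim N d)).image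
    (continuous_diagonalOp w)
  ext T
  constructor
  · rintro ⟨Γ, hΓ, rfl⟩
    obtain ⟨b, rfl⟩ := (mem_fixedSpecOps_iff hw).mp hΓ
    exact ⟨b, b.orthonormal, rfl⟩
  · rintro ⟨b, hb, rfl⟩
    obtain ⟨b', rfl⟩ := hb.exists_orthonormalBasis_eq rfl
    exact ⟨diagonalOp b' w, (mem_fixedSpecOps_iff hw).mpr ⟨b', rfl⟩, rfl⟩

theorem isClosed_kyFanOps (w : Fin (fermionDim N d) → ℝ) :
    IsClosed (LinearMap.toContinuousLinearMap '' kyFanOps (N := N) (d := d) w) := by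
  convert! isClosed_setOf_positive_kyFan (E := FermionSpace N d) w using 1
  rw [LinearEquiv.image_eq_preimage_symm]
  rfl

theorem isCompact_convexHull_fixedSpecOps {w : Fin (fermionDim N d) → ℝ}
    (hw : IsWeightVector w) :
    IsCompact (LinearMap.toContinuousLinearMap ''
      convexHull ℝ (fixedSpecOps (N := N) (d := d) w)) := by
  refine isCompact_of_isClosed_isBounded_of_clm (E := FermionSpace N d) ?_ ?_
  · rw [convexHull_fixedSpecOps_eq_kyFanOps hw]
    exact isClosed_kyFanOps w
  · exact isBounded_image_convexHull (E := FermionSpace N d) (isCompact_fixedSpecOps hw).isBounded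

end FixedSpectrum

/-! ### Constrained searches and the relaxed functional -/

section Functional

variable {N d : ℕ} [NeZero N]

/-- `oneRDM` as a linear map. -/
noncomputable def oneRDMLinear : FermionOp N d →ₗ[ℂ] Matrix (Fin d) (Fin d) ℂ where
  toFun := oneRDM
  map_add' A B := by
    ext i j
    simp [oneRDM, partialTrace, fermionMatrix, Finset.sum_add_distrib, mul_add]
  map_smul' c A := by
    ext i j
    simp [oneRDM, partialTrace, fermionMatrix, ← Finset.mul_sum, mul_left_comm]

/-- `interactionEnergy V` as a real linear map. -/
noncomputable def interactionEnergyLinear (V : FermionOp N d) : FermionOp N d →ₗ[ℝ] ℝ where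
  toFun := interactionEnergy V
  map_add' A B := by
    simp [interactionEnergy, LinearMap.add_comp]
  map_smul' r A := by
    have : r • A = (r : ℂ) • A := rfl
    simp [this, interactionEnergy, LinearMap.smul_comp]

/-- A continuous energy is minimized on a closed fibre of a compact set. -/
theorem isLeast_searchValues (V : FermionOp N d) {S : Set (FermionOp N d)}
    (hS : IsCompact (LinearMap.toContinuousLinearMap '' S)) {γ : Matrix (Fin d) (Fin d) ℂ}
    (hγ : γ ∈ oneRDM '' S) : IsLeast (searchValues V S γ) (sInf (searchValues V S γ)) := by
  have hrdm : Continuous fun T : FermionSpace N d →L[ℂ] FermionSpace N d =>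
      oneRDM (T : FermionOp N d) :=
    (oneRDMLinear ∘ₗ ContinuousLinearMap.coeLM ℂ).continuous_of_finiteDimensional
  have henergy : Continuous fun T : FermionSpace N d →L[ℂ] FermionSpace N d =>
      interactionEnergy V (T : FermionOp N d) :=
    Complex.continuous_re.comp (LinearMap.trace ℂ (FermionSpace N d) ∘ₗ
      LinearMap.lcomp ℂ (FermionSpace N d) V ∘ₗ
      ContinuousLinearMap.coeLM ℂ).continuous_of_finiteDimensional
  have hcompact := hS.inter_right (isClosed_singleton.preimage hrdm : IsClosed (_ ⁻¹' {γ}))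
  obtain ⟨Γ₀, hΓ₀, rfl⟩ := hγ
  obtain ⟨_, ⟨⟨Γ, hΓ, rfl⟩, hΓγ⟩, hmin⟩ := hcompact.exists_isMinOn
    ⟨LinearMap.toContinuousLinearMap Γ₀, ⟨Γ₀, hΓ₀, rfl⟩, rfl⟩ henergy.continuousOn
  have hleast : IsLeast (searchValues V S (oneRDM Γ₀)) (interactionEnergy V Γ : EReal) := by
    refine ⟨⟨Γ, hΓ, hΓγ, rfl⟩, ?_⟩
    rintro _ ⟨Γ', hΓ', hΓ'γ, rfl⟩
    exact EReal.coe_le_coe_iff.mpr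
      (hmin ⟨⟨Γ', hΓ', rfl⟩, hΓ'γ⟩)
  rwa [hleast.csInf_eq]

theorem oneRDM_image_convexHull (S : Set (FermionOp N d)) :
    oneRDM '' convexHull ℝ S = convexHull ℝ (oneRDM '' S) :=
  (oneRDMLinear.restrictScalars ℝ).image_convexHull S

theorem isConvexFun_sInf_searchValues (V : FermionOp N d) {S : Set (FermionOp N d)}
    (hconv : Convex ℝ S) (hS : IsCompact (LinearMap.toContinuousLinearMap '' S)) :
    IsConvexFun fun γ => sInf (searchValues V S γ) := by
  have hepi : Convex ℝ {p : FermionOp N d × ℝ | p.1 ∈ S ∧ interactionEnergy V p.1 ≤ p.2} := by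
    have h : IsLinearMap ℝ fun p : FermionOp N d × ℝ => interactionEnergy V p.1 - p.2 :=
      (interactionEnergyLinear V ∘ₗ LinearMap.fst ℝ _ ℝ - LinearMap.snd ℝ _ ℝ).isLinear
    have hle : Convex ℝ {p : FermionOp N d × ℝ | interactionEnergy V p.1 ≤ p.2} := by
      simpa only [sub_nonpos] using convex_halfSpace_le h 0
    exact (hconv.linear_preimage (LinearMap.fst ℝ (FermionOp N d) ℝ)).inter hle
  have himage := hepi.linear_image
    ((oneRDMLinear.restrictScalars ℝ).prodMap (LinearMap.id : ℝ →ₗ[ℝ] ℝ))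
  unfold IsConvexFun
  convert! himage using 1
  ext ⟨γ, a⟩
  constructor
  · intro (h : sInf (searchValues V S γ) ≤ a)
    have hne : γ ∈ oneRDM '' S := by
      by_contra hne
      have : searchValues V S γ = ∅ := Set.eq_empty_of_forall_notMem fun _ ⟨Γ, hΓ, hγ, _⟩ =>
        hne ⟨Γ, hΓ, hγ⟩
      simp [this] at h
    obtain ⟨⟨Γ, hΓ, hγ, he⟩, -⟩ := isLeast_searchValues V hS hne
    rw [he, EReal.coe_le_coe_iff] at h
    exact ⟨(Γ, a), ⟨hΓ, h⟩, Prod.ext hγ rfl⟩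
  · rintro ⟨⟨Γ, a'⟩, ⟨hΓ, hle⟩, heq⟩
    obtain ⟨hγ, rfl⟩ := Prod.ext_iff.mp heq
    have hmem : (interactionEnergy V Γ : EReal) ∈ searchValues V S γ := ⟨Γ, hΓ, hγ, rfl⟩
    exact (sInf_le hmem).trans (EReal.coe_le_coe_iff.mpr hle)

/-- The epigraph of `g` pulls back along `Γ ↦ (oneRDM Γ, Tr[Γ V])` to a convex set containing `S`,
hence its hull. -/
theorem IsConvexFun.le_interactionEnergy {V : FermionOp N d} {S : Set (FermionOp N d)}
    {g : Matrix (Fin d) (Fin d) ℂ → EReal} (hg : IsConvexFun g)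
    (hgS : g ≤ fun γ => sInf (searchValues V S γ)) {Γ : FermionOp N d}
    (hΓ : Γ ∈ convexHull ℝ S) : g (oneRDM Γ) ≤ interactionEnergy V Γ := by
  let f : FermionOp N d →ₗ[ℝ] Matrix (Fin d) (Fin d) ℂ × ℝ :=
    (oneRDMLinear.restrictScalars ℝ).prod (interactionEnergyLinear V)
  have hsub : S ⊆ f ⁻¹' {p | g p.1 ≤ (p.2 : EReal)} := fun Γ' hΓ' =>
    (hgS _).trans (sInf_le ⟨Γ', hΓ', rfl, rfl⟩)
  exact convexHull_min hsub (Convex.linear_preimage hg f) hΓ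

theorem relaxedFunctional_eq_sInf (V : FermionOp N d) {w : Fin (fermionDim N d) → ℝ}
    (hw : IsWeightVector w) (γ : Matrix (Fin d) (Fin d) ℂ) :
    relaxedFunctional V w γ = sInf (searchValues V (convexHull ℝ (fixedSpecOps w)) γ) := by
  apply le_antisymm
  · refine iSup₂_le fun g hg => le_sInf ?_
    rintro _ ⟨Γ, hΓ, rfl, rfl⟩
    exact hg.1.le_interactionEnergy hg.2 hΓ
  · refine le_iSup₂_of_le (fun γ => sInf (searchValues V (convexHull ℝ (fixedSpecOps w)) γ))
      ⟨isConvexFun_sInf_searchValues V (convex_convexHull ℝ _)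
        (isCompact_convexHull_fixedSpecOps hw), fun γ => sInf_le_sInf ?_⟩ le_rfl
    rintro _ ⟨Γ, hΓ, hγ, rfl⟩
    exact ⟨Γ, subset_convexHull ℝ _ hΓ, hγ, rfl⟩

end Functional

theorem theorem1 (N d : ℕ) [NeZero N] (V : FermionOp N d) (hV : IsHermitianOp V)
    (w : Fin (fermionDim N d) → ℝ) (hw : IsWeightVector w) :
    -- the minimum that defines `𝓕_w` is attained on its domain
    (∀ γ ∈ fixedSpecRDMs w,
      IsLeast (searchValues V (fixedSpecOps w) γ) (universalFunctional V w γ)) ∧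
    -- the relaxed functional is a constrained search over the convex hull of `𝓔^N(w)`
    (∀ γ ∈ convexHull ℝ (fixedSpecRDMs w),
      IsLeast (searchValues V (convexHull ℝ (fixedSpecOps w)) γ) (relaxedFunctional V w γ)) ∧
    -- the convex hull of `𝓔^N(w)`
    convexHull ℝ (fixedSpecOps w) =
      ⋃ w' ∈ {w' | IsWeightVector w' ∧ Majorized w' w}, fixedSpecOps w' ∧
    convexHull ℝ (fixedSpecOps w) =
      {Γ | Γ ∈ densityOps N d ∧ ∃ hΓ : IsHermitianOp Γ, Majorized (spec hΓ) w} ∧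
    -- the convex hull of `𝓔^1_N(w)`
    convexHull ℝ (fixedSpecRDMs w) = oneRDM '' convexHull ℝ (fixedSpecOps w) ∧
    convexHull ℝ (fixedSpecRDMs w) =
      ⋃ w' ∈ {w' | IsWeightVector w' ∧ Majorized w' w}, fixedSpecRDMs w' := by
  have hrdm : convexHull ℝ (fixedSpecRDMs w) = oneRDM '' convexHull ℝ (fixedSpecOps w) :=
    (oneRDM_image_convexHull _).symm
  have hmaj := convexHull_fixedSpecOps_eq_majorized hw
  have hunion := hmaj.trans (majorized_eq_iUnion_fixedSpecOps w)
  refine ⟨fun γ hγ => isLeast_searchValues V (isCompact_fixedSpecOps hw) hγ, fun γ hγ => ?_,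
    hunion, hmaj, hrdm, ?_⟩
  · rw [relaxedFunctional_eq_sInf V hw]
    exact isLeast_searchValues V (isCompact_convexHull_fixedSpecOps hw) (hrdm ▸ hγ)
  · rw [hrdm, hunion, Set.image_iUnion₂]
    rfl
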